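/- Let $X,Y$ be compact metric spaces, $0\in X$ a distinguished point, and $\hat f=\{f_t:Y\to Y\}_{t\in X}$ a family of maps such that $(t,x)\mapsto f_t(x)$ is continuous on $X\times Y$. Let $(\theta_\varepsilon)_{\varepsilon>0}$ be non-atomic Borel probability measures on $X$ with $\operatorname{supp}\theta_\varepsilon\to\{0\}$ as $\varepsilon\to0$ (every neighbourhood of $0$ contains $\operatorname{supp}\theta_\varepsilon$ for all small $\varepsilon>0$). Write $\Omega=X^{\mathbb N}$, $\theta^\varepsilon=\theta_\varepsilon^{\mathbb N}$, and $f_\omega^n=f_{\omega_n}\circ\dots\circ f_{\omega_1}$, $f^0_\omega=\mathrm{id}$, for $\omega=(\omega_1,\omega_2,\dots)\in\Omega$. A Borel probability measure $\mu^\varepsilon$ on $Y$ is *stationary* for $(\hat f,\theta_\varepsilon)$ if $\theta^\varepsilon\times\mu^\varepsilon$ is invariant under $F(\omega,x)=(\sigma\omega,f_{\omega_1}(x))$, where $\sigma$ is the left shift. For a finite Borel partition $\xi$ of $Y$ and a Borel probability measure $\nu$ put $H_\nu(\xi)=-\sum_{A\in\xi}\nu(A)\log\nu(A)$, $$h_{\mu^\varepsilon}((\hat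 f,\theta_\varepsilon),\xi)=\lim_{n\to\infty}\frac1n\int H_{\mu^\varepsilon}\Big(\bigvee_{j=0}^{n-1}(f_\omega^j)^{-1}\xi\Big)\,d\theta^\varepsilon(\omega),\qquad h_\mu(f_0,\xi)=\lim_{n\to\infty}\frac1n H_\mu\Big(\bigvee_{j=0}^{n-1}(f_0^j)^{-1}\xi\Big).$$ **Theorem.** Let $\varepsilon_k>0$, $\varepsilon_k\to0$, let $\mu^{\varepsilon_k}$ be a stationary measure for $(\hat f,\theta_{\varepsilon_k})$ for every $k$, and suppose that $\mu^{\varepsilon_k}\to\mu$ in the weak$^*$ topology. Let $\xi$ be a finite Borel partition of $Y$ which is random-generating for every $k$, i.e. for $\theta^{\varepsilon_k}$-almost every $\omega$ the $\sigma$-algebra generated by the partitions $(f_\omega^j)^{-1}\xi$, $j\ge0$, equals the Borel $\sigma$-algebra of $Y$ modulo $\mu^{\varepsilon_k}$-null sets; and suppose $\mu(\partial\xi)=0$, where $\partial\xi$ is the union of the topological boundaries of the elements of $\xi$. Then the limits defining $h_{\mu^{\varepsilon_k}}((\hat f,\theta_{\varepsilon_k}),\xi)$ for every $k$ and $h_\mu(f_0,\xi)$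 exist in $\mathbb R$, and $$\limsup_{k\to\infty}h_{\mu^{\varepsilon_k}}((\hat f,\theta_{\varepsilon_k}),\xi)\le h_\mu(f_0,\xi).$$ -/

import Mathlib

open MeasureTheory Filter Topology

namespace RandomEntropy

/-- A finite measurable partition of `Y`, with cells indexed by `ι` (cells may be empty). -/
structure FinMeasPartition (ι Y : Type*) [Fintype ι] [MeasurableSpace Y] where
  cell : ι → Set Y
  measurableSet_cell : ∀ i, MeasurableSet (cell i)
  disjoint_cell : Pairwise (fun i j => Disjoint (cell i) (cell j))
  iUnion_cell : ⋃ i, cell i = Set.univ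

/-- The union of the topological boundaries of the cells of a partition. -/
def FinMeasPartition.boundary {ι Y : Type*} [Fintype ι] [MeasurableSpace Y] [TopologicalSpace Y]
    (ξ : FinMeasPartition ι Y) : Set Y :=
  ⋃ i, frontier (ξ.cell i)

/-- The cells of the join `⋁_{j < n} (T j)⁻¹ ξ`, indexed by itineraries of length `n`. -/
def joinCell {ι Y : Type*} [Fintype ι] [MeasurableSpace Y]
    (ξ : FinMeasPartition ι Y) (T : ℕ → Y → Y) (n : ℕ) (a : Fin n → ι) : Set Y :=
  ⋂ j : Fin n, T j ⁻¹' ξ.cell (a j)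

/-- The Shannon entropy `H_μ(⋁_{j < n} (T j)⁻¹ ξ) = - ∑ μ(P) log μ(P)`. -/
noncomputable def joinEntropy {ι Y : Type*} [Fintype ι] [MeasurableSpace Y]
    (μ : Measure Y) (ξ : FinMeasPartition ι Y) (T : ℕ → Y → Y) (n : ℕ) : ℝ :=
  ∑ a : Fin n → ι, Real.negMulLog (μ.real (joinCell ξ T n a))

/-- `(1/n) H_μ(⋁_{j < n} (g^j)⁻¹ ξ)`. -/
noncomputable def meanEntropy {ι Y : Type*} [Fintype ι] [MeasurableSpace Y]
    (μ : Measure Y) (g : Y → Y) (ξ : FinMeasPartition ι Y) (n : ℕ) : ℝ :=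
  (1 / (n : ℝ)) * joinEntropy μ ξ (fun j => g^[j]) n

/-- The metric entropy `h_μ(g, ξ)` of the map `g` with respect to the partition `ξ`. -/
noncomputable def entropy {ι Y : Type*} [Fintype ι] [MeasurableSpace Y]
    (μ : Measure Y) (g : Y → Y) (ξ : FinMeasPartition ι Y) : ℝ :=
  limUnder atTop (meanEntropy μ g ξ)

/-- The random iterates `f_ω^n = f_{ω_n} ∘ ⋯ ∘ f_{ω_1}`; the `k`-th parameter `ω_k`, `k ≥ 1`, is
`ω (k - 1)`. -/
def randomIterate {X Y : Type*} (f : X → Y → Y) (ω : ℕ → X) : ℕ → Y → Y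
  | 0 => id
  | n + 1 => f (ω n) ∘ randomIterate f ω n

/-- The skew product `F(ω, x) = (σ ω, f_{ω_1}(x))`. -/
def skewProduct {X Y : Type*} (f : X → Y → Y) (p : (ℕ → X) × Y) : (ℕ → X) × Y :=
  (fun n => p.1 (n + 1), f (p.1 0) p.2)

/-- The product probability measure `θ^ℕ` on the space of parameter sequences. -/
noncomputable def noiseMeasure {X : Type*} [MeasurableSpace X]
    (θ : ProbabilityMeasure X) : Measure (ℕ → X) :=
  Measure.infinitePi (fun _ : ℕ => (θ : Measure X))

/-- `μ` is a stationary measure of the random system `(f, θ)`: the measure `θ^ℕ × μ` is invariant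
under the skew product. -/
def IsStationary {X Y : Type*} [MeasurableSpace X] [MeasurableSpace Y]
    (f : X → Y → Y) (θ : ProbabilityMeasure X) (μ : ProbabilityMeasure Y) : Prop :=
  MeasurePreserving (skewProduct f)
    ((noiseMeasure θ).prod (μ : Measure Y)) ((noiseMeasure θ).prod (μ : Measure Y))

/-- `(1/n) ∫ H_μ(⋁_{j < n} (f_ω^j)⁻¹ ξ) dθ^ℕ(ω)`. -/
noncomputable def meanRandomEntropy {ι X Y : Type*} [Fintype ι] [MeasurableSpace X]
    [MeasurableSpace Y] (μ : Measure Y) (f : X → Y → Y) (θ : ProbabilityMeasure X)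
    (ξ : FinMeasPartition ι Y) (n : ℕ) : ℝ :=
  (1 / (n : ℝ)) * ∫ ω, joinEntropy μ ξ (randomIterate f ω) n ∂(noiseMeasure θ)

/-- The entropy `h_μ((f, θ), ξ)` of the random dynamical system `(f, θ)` with respect to `ξ`. -/
noncomputable def randomEntropy {ι X Y : Type*} [Fintype ι] [MeasurableSpace X]
    [MeasurableSpace Y] (μ : Measure Y) (f : X → Y → Y) (θ : ProbabilityMeasure X)
    (ξ : FinMeasPartition ι Y) : ℝ :=
  limUnder atTop (meanRandomEntropy μ f θ ξ)

/-- `ξ` is a random generating partition for `(f, θ)` and `μ`: for almost every `ω`, every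
measurable set agrees modulo `μ` with a set of the σ-algebra generated by the partitions
`(f_ω^j)⁻¹ ξ`, `j ≥ 0`. -/
def IsRandomGenerating {ι X Y : Type*} [Fintype ι] [MeasurableSpace X] [MeasurableSpace Y]
    (μ : Measure Y) (f : X → Y → Y) (θ : ProbabilityMeasure X)
    (ξ : FinMeasPartition ι Y) : Prop :=
  ∀ᵐ ω ∂(noiseMeasure θ), ∀ A : Set Y, MeasurableSet A →
    ∃ B : Set Y,
      MeasurableSet[MeasurableSpace.generateFrom
        {S | ∃ (j : ℕ) (i : ι), S = randomIterate f ω j ⁻¹' ξ.cell i}] B ∧ A =ᵐ[μ] B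

end RandomEntropy

/-!
The entropy of a stationary random system with respect to a fixed partition `ξ` is the infimum of
the mean entropies over finitely many steps, and each of these is asymptotically bounded by the mean
entropy of the unperturbed map. An infimum of upper semicontinuous quantities is upper
semicontinuous.

*Existence of the limits.* For a stationary `ν`, the averaged entropy
`a n = ∫ H_ν(⋁_{j<n} (f_ω^j)⁻¹ ξ) dθ^ℕ(ω)` is subadditive
(`subadditive_integral_joinEntropy`). Subadditivity of Shannon entropy bounds `a (n + m)` by `a n`
plus the average of the entropy of `⋁_{j<m} (f_ω^{n+j})⁻¹ ξ`. The cells of this last join are fibres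
of the preimage under `F^n` of a subset of `X^ℕ × Y`. As `F` preserves `θ^ℕ × ν`, the conditional
expectation of the fibre measures of `F⁻¹ E` given the shifted noise is the fibre measure of `E`,
so conditional Jensen for the concave `-x log x` shows that pulling back by `F` lowers the average
(`integral_negMulLog_fibre_preimage_le`). Fekete's lemma gives the limit, which is at most
`a n / n` for each `n ≥ 1`. The deterministic map `f t₀` is the case where the noise is a Dirac
mass.

*Semicontinuity.* Jensen's inequality also gives
`a n ≤ ∑ -m log m` with `m` the `θ^ℕ × ν` measures of the cells of length `n` in the skew product
(`integral_joinEntropy_le`). The measures `θ_{ε k}^ℕ × ν k` converge weakly to `δ × μ`, with `δ` the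
Dirac mass at the constant sequence `t₀` (`tendsto_noise_prod`); the limit is again invariant, so
the cells of the skew product have null boundary for it and the portmanteau theorem makes the bound
converge to `H_μ(⋁_{j<n} (f_{t₀}^j)⁻¹ ξ)` (`tendsto_sum_negMulLog_skewCell`). Dividing by `n` and
letting `n → ∞` after `k → ∞` yields the inequality.
-/

namespace RandomEntropy

/-! ### Shannon entropy of finite joins -/

/-- Subadditivity of Shannon entropy: the entropy of a joint distribution is at most the sum of the
entropies of its marginals. -/
theorem sum_negMulLog_le_add {α β : Type*} [Fintype α] [Fintype β] (q : α → β → ℝ)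
    (hq : ∀ a b, 0 ≤ q a b) (hsum : ∑ a, ∑ b, q a b = 1) :
    ∑ a, ∑ b, Real.negMulLog (q a b) ≤
      ∑ a, Real.negMulLog (∑ b, q a b) + ∑ b, Real.negMulLog (∑ a, q a b) := by
  obtain ⟨r, hr⟩ : ∃ r : α → ℝ, ∀ a, r a = ∑ b, q a b := ⟨_, fun _ => rfl⟩
  obtain ⟨s, hs⟩ : ∃ s : β → ℝ, ∀ b, s b = ∑ a, q a b := ⟨_, fun _ => rfl⟩
  simp only [← hr, ← hs]
  -- Nonnegativity of the relative entropy of `q` with respect to `r ⊗ s`, from `log x ≤ x - 1`; the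
  -- correction terms `r a * s b - q a b` sum to zero.
  have key (a b) : Real.negMulLog (q a b) ≤
      (-(q a b * Real.log (r a)) - q a b * Real.log (s b)) + (r a * s b - q a b) := by
    have hra : q a b ≤ r a :=
      hr a ▸ Finset.single_le_sum (fun b _ => hq a b) (Finset.mem_univ b)
    have hsb : q a b ≤ s b :=
      hs b ▸ Finset.single_le_sum (f := fun a => q a b) (fun a _ => hq a b) (Finset.mem_univ a)
    rcases (hq a b).eq_or_lt with h0 | h0
    · rw [← h0] at hra hsb ⊢
      simpa using mul_nonneg hra hsb
    · have hr0 := h0.trans_le hra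
      have hs0 := h0.trans_le hsb
      have h := mul_le_mul_of_nonneg_left
        (Real.log_le_sub_one_of_pos (div_pos (mul_pos hr0 hs0) h0)) h0.le
      rw [Real.log_div (mul_pos hr0 hs0).ne' h0.ne', Real.log_mul hr0.ne' hs0.ne', mul_sub,
        mul_sub, mul_div_cancel₀ _ h0.ne'] at h
      rw [Real.negMulLog]
      linarith
  have hs1 : ∑ b, s b = 1 := by simp_rw [hs, ← hsum]; exact Finset.sum_comm
  have h1 : ∑ a, ∑ b, q a b * Real.log (r a) = ∑ a, r a * Real.log (r a) := by
    simp_rw [hr, Finset.sum_mul]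
  have h2 : ∑ a, ∑ b, q a b * Real.log (s b) = ∑ b, s b * Real.log (s b) := by
    rw [Finset.sum_comm]
    simp_rw [hs, Finset.sum_mul]
  have h3 : ∑ a, ∑ b, r a * s b = 1 := by
    simp_rw [← Finset.mul_sum, hs1, mul_one, hr, hsum]
  refine (Finset.sum_le_sum fun a _ => Finset.sum_le_sum fun b _ => key a b).trans_eq ?_
  simp only [Finset.sum_add_distrib, Finset.sum_sub_distrib, Finset.sum_neg_distrib, h1, h2, h3,
    hsum, Real.negMulLog, neg_mul]
  ring

section Join

variable {ι Y : Type*} [Fintype ι] [MeasurableSpace Y] (ξ : FinMeasPartition ι Y)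

theorem FinMeasPartition.existsUnique_mem (y : Y) : ∃! i, y ∈ ξ.cell i := by
  have : y ∈ ⋃ i, ξ.cell i := ξ.iUnion_cell ▸ Set.mem_univ y
  obtain ⟨i, hi⟩ := Set.mem_iUnion.1 this
  refine ⟨i, hi, fun j hj => ?_⟩
  by_contra hne
  exact Set.disjoint_left.1 (ξ.disjoint_cell hne) hj hi

theorem mem_joinCell {T : ℕ → Y → Y} {n : ℕ} {a : Fin n → ι} {y : Y} :
    y ∈ joinCell ξ T n a ↔ ∀ j, T j y ∈ ξ.cell (a j) := by
  simp [joinCell]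

theorem measurableSet_joinCell {T : ℕ → Y → Y} (hT : ∀ j, Measurable (T j)) (n : ℕ)
    (a : Fin n → ι) : MeasurableSet (joinCell ξ T n a) :=
  MeasurableSet.iInter fun j => hT j (ξ.measurableSet_cell _)

theorem joinCell_append (T : ℕ → Y → Y) {n m : ℕ} (b : Fin n → ι) (c : Fin m → ι) :
    joinCell ξ T (n + m) (Fin.append b c) =
      joinCell ξ T n b ∩ joinCell ξ (fun j => T (n + j)) m c := by
  ext y
  simp [mem_joinCell, Fin.forall_fin_add]

/-- The cells of a join partition any measurable set, as far as measures are concerned. -/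
theorem sum_measureReal_inter_joinCell (μ : Measure Y) [IsFiniteMeasure μ] {T : ℕ → Y → Y}
    (hT : ∀ j, Measurable (T j)) (n : ℕ) {B : Set Y} (hB : MeasurableSet B) :
    ∑ a, μ.real (B ∩ joinCell ξ T n a) = μ.real B := by
  rw [← measureReal_iUnion_fintype]
  · rw [← Set.inter_iUnion, Set.inter_eq_left.2]
    intro y _
    choose i hi using fun j => (ξ.existsUnique_mem (T j y)).exists
    exact Set.mem_iUnion.2 ⟨fun j => i j, (mem_joinCell ξ).2 fun j => hi j⟩
  · intro a b hab
    refine Set.disjoint_left.2 fun y hy hy' => hab (funext fun j => ?_)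
    exact (ξ.existsUnique_mem (T j y)).unique ((mem_joinCell ξ).1 hy.2 j)
      ((mem_joinCell ξ).1 hy'.2 j)
  · exact fun a => hB.inter (measurableSet_joinCell ξ hT n a)

theorem joinEntropy_nonneg (μ : Measure Y) [IsProbabilityMeasure μ] (T : ℕ → Y → Y) (n : ℕ) :
    0 ≤ joinEntropy μ ξ T n :=
  Finset.sum_nonneg fun _ _ => Real.negMulLog_nonneg measureReal_nonneg measureReal_le_one

theorem joinEntropy_add_le (μ : Measure Y) [IsProbabilityMeasure μ] {T : ℕ → Y → Y}
    (hT : ∀ j, Measurable (T j)) (n m : ℕ) :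
    joinEntropy μ ξ T (n + m) ≤
      joinEntropy μ ξ T n + joinEntropy μ ξ (fun j => T (n + j)) m := by
  have hT' : ∀ j, Measurable (T (n + j)) := fun j => hT _
  have hrow (b : Fin n → ι) :
      ∑ c, μ.real (joinCell ξ T n b ∩ joinCell ξ (fun j => T (n + j)) m c) =
        μ.real (joinCell ξ T n b) :=
    sum_measureReal_inter_joinCell ξ μ hT' m (measurableSet_joinCell ξ hT n b)
  have hcol (c : Fin m → ι) :
      ∑ b, μ.real (joinCell ξ T n b ∩ joinCell ξ (fun j => T (n + j)) m c) =
        μ.real (joinCell ξ (fun j => T (n + j)) m c) := by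
    simp_rw [Set.inter_comm (joinCell ξ T n _)]
    exact sum_measureReal_inter_joinCell ξ μ hT n (measurableSet_joinCell ξ hT' m c)
  have htot : ∑ b, μ.real (joinCell ξ T n b) = 1 := by
    simpa using sum_measureReal_inter_joinCell ξ μ hT n MeasurableSet.univ
  have h := sum_negMulLog_le_add
    (fun b c => μ.real (joinCell ξ T n b ∩ joinCell ξ (fun j => T (n + j)) m c))
    (fun _ _ => measureReal_nonneg) (by simp_rw [hrow, htot])
  simp_rw [hrow, hcol] at h
  refine le_of_eq_of_le ?_ h
  rw [joinEntropy, ← (Fin.appendEquiv n m).sum_comp, Fintype.sum_prod_type]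
  simp [Fin.appendEquiv, joinCell_append]

end Join

/-! ### Entropy of the fibres of a set in a product -/

section Fibre

variable {Ω Y : Type*} [MeasurableSpace Ω] [MeasurableSpace Y]
  {P : Measure Ω} {ν : Measure Y} [IsProbabilityMeasure ν]

theorem measurable_measureReal_fibre {E : Set (Ω × Y)} (hE : MeasurableSet E) :
    Measurable fun ω => ν.real (Prod.mk ω ⁻¹' E) :=
  (measurable_measure_prodMk_left hE).ennreal_toReal

theorem setIntegral_measureReal_fibre {E : Set (Ω × Y)} (hE : MeasurableSet E) {B : Set Ω}
    (hB : MeasurableSet B) :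
    ∫ ω in B, ν.real (Prod.mk ω ⁻¹' E) ∂P = (P.prod ν).real (Prod.fst ⁻¹' B ∩ E) := by
  have hBE : MeasurableSet (Prod.fst ⁻¹' B ∩ E) := (measurable_fst hB).inter hE
  rw [measureReal_def, Measure.prod_apply hBE, ← integral_toReal
    (measurable_measure_prodMk_left hBE).aemeasurable (.of_forall fun _ => measure_lt_top _ _),
    ← integral_indicator hB]
  refine integral_congr_ae (.of_forall fun ω => ?_)
  by_cases h : ω ∈ B
  · simp [h, measureReal_def, Set.preimage_preimage]
  · simp [h, Set.preimage_preimage]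

variable [IsProbabilityMeasure P]

theorem integrable_measureReal_fibre {E : Set (Ω × Y)} (hE : MeasurableSet E) :
    Integrable (fun ω => ν.real (Prod.mk ω ⁻¹' E)) P :=
  Integrable.of_bound (measurable_measureReal_fibre hE).aestronglyMeasurable 1
    (.of_forall fun _ => by
      rw [Real.norm_of_nonneg measureReal_nonneg]; exact measureReal_le_one)

theorem integrable_negMulLog_fibre {E : Set (Ω × Y)} (hE : MeasurableSet E) :
    Integrable (fun ω => Real.negMulLog (ν.real (Prod.mk ω ⁻¹' E))) P := by
  obtain ⟨C, hC⟩ := isCompact_Icc.exists_bound_of_continuousOn (s := Set.Icc (0 : ℝ) 1)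
    Real.continuous_negMulLog.continuousOn
  exact Integrable.of_bound (Real.continuous_negMulLog.measurable.comp
      (measurable_measureReal_fibre hE)).aestronglyMeasurable C
    (.of_forall fun _ => hC _ ⟨measureReal_nonneg, measureReal_le_one⟩)

theorem integral_negMulLog_fibre_le {E : Set (Ω × Y)} (hE : MeasurableSet E) :
    ∫ ω, Real.negMulLog (ν.real (Prod.mk ω ⁻¹' E)) ∂P ≤
      Real.negMulLog ((P.prod ν).real E) := by
  have h := setIntegral_measureReal_fibre (P := P) (ν := ν) hE MeasurableSet.univ
  simp only [setIntegral_univ, Set.preimage_univ, Set.univ_inter] at h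
  rw [← h]
  exact Real.concaveOn_negMulLog.le_map_integral Real.continuous_negMulLog.continuousOn
    isClosed_Ici (.of_forall fun _ => measureReal_nonneg) (integrable_measureReal_fibre hE)
    (integrable_negMulLog_fibre hE)

/-- Pulling a set back by a measure-preserving skew product lowers the average of `-x log x` over
its fibre measures: the fibre measure of `E` over `σ ω` is the conditional expectation given `σ` of
the fibre measure of `F ⁻¹' E`, and `-x log x` is concave. -/
theorem integral_negMulLog_fibre_preimage_le {F : Ω × Y → Ω × Y} {σ : Ω → Ω}
    (hF : MeasurePreserving F (P.prod ν) (P.prod ν)) (hσ : Measurable σ)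
    (hFσ : ∀ p, (F p).1 = σ p.1) {E : Set (Ω × Y)} (hE : MeasurableSet E) :
    ∫ ω, Real.negMulLog (ν.real (Prod.mk ω ⁻¹' (F ⁻¹' E))) ∂P ≤
      ∫ ω, Real.negMulLog (ν.real (Prod.mk ω ⁻¹' E)) ∂P := by
  -- `σ` is a factor of `F`, the first marginal of `P × ν` being `P`.
  have hσP : MeasurePreserving σ P P := by
    refine ⟨hσ, ?_⟩
    have h1 : (P.prod ν).map Prod.fst = P := by simp
    conv_lhs => rw [← h1]
    rw [Measure.map_map hσ measurable_fst]
    conv_rhs => rw [← h1, ← hF.map_eq]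
    rw [Measure.map_map measurable_fst hF.measurable]
    congr 1
    funext p
    exact (hFσ p).symm
  have hm : MeasurableSpace.comap σ inferInstance ≤ (inferInstance : MeasurableSpace Ω) :=
    hσ.comap_le
  have hFE := hF.measurable hE
  have hcond : (fun ω => ν.real (Prod.mk (σ ω) ⁻¹' E)) =ᵐ[P]
      P[fun ω => ν.real (Prod.mk ω ⁻¹' (F ⁻¹' E)) | MeasurableSpace.comap σ inferInstance] := by
    refine ae_eq_condExp_of_forall_setIntegral_eq hm (integrable_measureReal_fibre hFE)
      (fun _ _ _ => (hσP.integrable_comp_of_integrable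
        (integrable_measureReal_fibre hE)).integrableOn) ?_ ?_
    · rintro _ ⟨B, hB, rfl⟩ _
      rw [setIntegral_measureReal_fibre hFE (hσ hB),
        ← setIntegral_map (f := fun ω => ν.real (Prod.mk ω ⁻¹' E)) hB (by
          rw [hσP.map_eq]; exact (integrable_measureReal_fibre hE).aestronglyMeasurable)
          hσ.aemeasurable, hσP.map_eq, setIntegral_measureReal_fibre hE hB,
        ← hF.measureReal_preimage ((measurable_fst hB).inter hE).nullMeasurableSet]
      congr 1
      ext p
      simp [hFσ]
    · exact ((measurable_measureReal_fibre hE).comp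
        (comap_measurable σ)).stronglyMeasurable.aestronglyMeasurable
  have hJ := Real.concaveOn_negMulLog.condExp_map_le hm
    (Real.continuous_negMulLog.upperSemicontinuous.upperSemicontinuousOn _)
    (.of_forall fun ω => measureReal_nonneg) isClosed_Ici
    (integrable_measureReal_fibre (P := P) (ν := ν) hFE) (integrable_negMulLog_fibre hFE)
  calc _ = ∫ ω, (P[fun ω => Real.negMulLog (ν.real (Prod.mk ω ⁻¹' (F ⁻¹' E))) |
            MeasurableSpace.comap σ inferInstance]) ω ∂P := (integral_condExp hm).symm
    _ ≤ ∫ ω, Real.negMulLog (ν.real (Prod.mk (σ ω) ⁻¹' E)) ∂P := by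
        refine integral_mono_ae integrable_condExp (hσP.integrable_comp_of_integrable
          (integrable_negMulLog_fibre hE)) ?_
        filter_upwards [hJ, hcond] with ω h1 h2
        refine h1.trans_eq ?_
        simp only [Function.comp_apply, ← h2]
    _ = _ := by
        have := integral_map (μ := P) hσ.aemeasurable
          (f := fun ω => Real.negMulLog (ν.real (Prod.mk ω ⁻¹' E))) (by
            rw [hσP.map_eq]; exact (integrable_negMulLog_fibre hE).aestronglyMeasurable)
        rw [hσP.map_eq] at this
        exact this.symm

end Fibre

/-! ### Iterates and cells of the skew product -/

section Iterates

variable {X Y : Type*} (f : X → Y → Y)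

theorem skewProduct_iterate (n : ℕ) (p : (ℕ → X) × Y) :
    (skewProduct f)^[n] p = (fun j => p.1 (n + j), randomIterate f p.1 n p.2) := by
  induction n with
  | zero => simp [randomIterate]
  | succ n ih =>
    rw [Function.iterate_succ_apply', ih]
    simp only [skewProduct, randomIterate, Function.comp_apply, add_zero, Prod.mk.injEq, and_true]
    funext j
    rw [Nat.add_right_comm, add_assoc]

theorem randomIterate_add (ω : ℕ → X) (n j : ℕ) :
    randomIterate f ω (n + j) = randomIterate f (fun i => ω (n + i)) j ∘ randomIterate f ω n := by
  induction j with
  | zero => rfl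
  | succ j ih => rw [← add_assoc, randomIterate, ih]; rfl

theorem randomIterate_const (t : X) (n : ℕ) : randomIterate f (fun _ => t) n = (f t)^[n] := by
  induction n with
  | zero => rfl
  | succ n ih => rw [randomIterate, ih, Function.iterate_succ']

end Iterates

section SkewCell

variable {ι X Y : Type*} [Fintype ι] [MeasurableSpace Y] (f : X → Y → Y)
  (ξ : FinMeasPartition ι Y)

/-- The set of pairs `(ω, y)` such that the random orbit of `y` driven by `ω` has itinerary `a`
during the first `n` steps; its fibre over `ω` is the cell of the join of index `a`. -/
def skewCell (n : ℕ) (a : Fin n → ι) : Set ((ℕ → X) × Y) :=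
  ⋂ j : Fin n, (fun p => ((skewProduct f)^[j] p).2) ⁻¹' ξ.cell (a j)

theorem fibre_skewCell (n : ℕ) (a : Fin n → ι) (ω : ℕ → X) :
    Prod.mk ω ⁻¹' skewCell f ξ n a = joinCell ξ (randomIterate f ω) n a := by
  ext y
  simp [skewCell, joinCell, skewProduct_iterate]

theorem fibre_iterate_preimage_skewCell (n m : ℕ) (a : Fin m → ι) (ω : ℕ → X) :
    Prod.mk ω ⁻¹' ((skewProduct f)^[n] ⁻¹' skewCell f ξ m a) =
      joinCell ξ (fun j => randomIterate f ω (n + j)) m a := by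
  ext y
  simp [skewCell, joinCell, skewProduct_iterate, randomIterate_add]

end SkewCell

/-! ### Subadditivity and existence of the entropy -/

section RandomSystem

variable {ι X Y : Type*} [Fintype ι] [MeasurableSpace X] [MeasurableSpace Y]
  {f : X → Y → Y} (θ : ProbabilityMeasure X) (ξ : FinMeasPartition ι Y)

instance : IsProbabilityMeasure (noiseMeasure θ) := by
  unfold noiseMeasure
  infer_instance

theorem measurable_skewProduct (hf : Measurable fun p : X × Y => f p.1 p.2) :
    Measurable (skewProduct f) :=
  (measurable_pi_lambda _ fun n => (measurable_pi_apply (n + 1)).comp measurable_fst).prodMk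
    (hf.comp (f := fun p : (ℕ → X) × Y => (p.1 0, p.2))
      (((measurable_pi_apply 0).comp measurable_fst).prodMk measurable_snd))

theorem measurable_randomIterate (hf : Measurable fun p : X × Y => f p.1 p.2) (ω : ℕ → X) (n : ℕ) :
    Measurable (randomIterate f ω n) := by
  induction n with
  | zero => exact measurable_id
  | succ n ih => exact (hf.comp measurable_prodMk_left).comp ih

theorem measurableSet_skewCell (hf : Measurable fun p : X × Y => f p.1 p.2) (n : ℕ)
    (a : Fin n → ι) : MeasurableSet (skewCell f ξ n a) :=
  MeasurableSet.iInter fun j =>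
    (measurable_snd.comp ((measurable_skewProduct hf).iterate j)) (ξ.measurableSet_cell _)

theorem integrable_joinEntropy (ν : Measure Y) [IsProbabilityMeasure ν]
    (hf : Measurable fun p : X × Y => f p.1 p.2) (n : ℕ) :
    Integrable (fun ω => joinEntropy ν ξ (randomIterate f ω) n) (noiseMeasure θ) := by
  simp_rw [joinEntropy, ← fibre_skewCell]
  exact integrable_finsetSum _ fun a _ =>
    integrable_negMulLog_fibre (measurableSet_skewCell ξ hf n a)

/-- Averaging over the noise before taking the entropy increases it (Jensen). -/
theorem integral_joinEntropy_le (ν : Measure Y) [IsProbabilityMeasure ν]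
    (hf : Measurable fun p : X × Y => f p.1 p.2) (n : ℕ) :
    ∫ ω, joinEntropy ν ξ (randomIterate f ω) n ∂(noiseMeasure θ) ≤
      ∑ a, Real.negMulLog (((noiseMeasure θ).prod ν).real (skewCell f ξ n a)) := by
  simp_rw [joinEntropy, ← fibre_skewCell]
  rw [integral_finsetSum _ fun a _ =>
    integrable_negMulLog_fibre (measurableSet_skewCell ξ hf n a)]
  exact Finset.sum_le_sum fun a _ =>
    integral_negMulLog_fibre_le (measurableSet_skewCell ξ hf n a)

theorem subadditive_integral_joinEntropy {ν : ProbabilityMeasure Y}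
    (hf : Measurable fun p : X × Y => f p.1 p.2) (hν : IsStationary f θ ν) :
    Subadditive fun n =>
      ∫ ω, joinEntropy (ν : Measure Y) ξ (randomIterate f ω) n ∂(noiseMeasure θ) := by
  intro n m
  have hE := measurableSet_skewCell ξ hf m
  have hEn (a : Fin m → ι) : MeasurableSet ((skewProduct f)^[n] ⁻¹' skewCell f ξ m a) :=
    (measurable_skewProduct hf).iterate n (hE a)
  have hint : Integrable (fun ω =>
      joinEntropy (ν : Measure Y) ξ (fun j => randomIterate f ω (n + j)) m) (noiseMeasure θ) := by
    simp_rw [joinEntropy, ← fibre_iterate_preimage_skewCell]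
    exact integrable_finsetSum _ fun a _ => integrable_negMulLog_fibre (hEn a)
  have hle : ∫ ω, joinEntropy (ν : Measure Y) ξ (fun j => randomIterate f ω (n + j)) m
        ∂(noiseMeasure θ) ≤
      ∫ ω, joinEntropy (ν : Measure Y) ξ (randomIterate f ω) m ∂(noiseMeasure θ) := by
    simp_rw [joinEntropy, ← fibre_iterate_preimage_skewCell, ← fibre_skewCell]
    rw [integral_finsetSum _ fun a _ => integrable_negMulLog_fibre (hEn a),
      integral_finsetSum _ fun a _ => integrable_negMulLog_fibre (hE a)]
    refine Finset.sum_le_sum fun a _ => ?_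
    exact integral_negMulLog_fibre_preimage_le (σ := fun ω j => ω (n + j)) (hν.iterate n)
      (measurable_pi_lambda _ fun j => measurable_pi_apply _)
      (fun p => by rw [skewProduct_iterate]) (hE a)
  calc _ ≤ ∫ ω, (joinEntropy (ν : Measure Y) ξ (randomIterate f ω) n +
        joinEntropy (ν : Measure Y) ξ (fun j => randomIterate f ω (n + j)) m)
          ∂(noiseMeasure θ) :=
        integral_mono (integrable_joinEntropy θ ξ _ hf _)
          ((integrable_joinEntropy θ ξ _ hf _).add hint)
          fun ω => joinEntropy_add_le ξ _ (measurable_randomIterate hf ω) n m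
    _ ≤ _ := by
        rw [integral_add (integrable_joinEntropy θ ξ _ hf _) hint]
        gcongr

/-- The entropy of a stationary random system exists as a limit and is a lower bound of the mean
entropies, by Fekete's lemma. -/
theorem tendsto_meanRandomEntropy_and_le {ν : ProbabilityMeasure Y}
    (hf : Measurable fun p : X × Y => f p.1 p.2) (hν : IsStationary f θ ν) :
    Tendsto (meanRandomEntropy (ν : Measure Y) f θ ξ) atTop
        (𝓝 (randomEntropy (ν : Measure Y) f θ ξ)) ∧
      ∀ n ≠ 0, randomEntropy (ν : Measure Y) f θ ξ ≤ meanRandomEntropy (ν : Measure Y) f θ ξ n := by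
  have hsub := subadditive_integral_joinEntropy θ ξ hf hν
  have hbdd : BddBelow (Set.range fun n : ℕ =>
      (∫ ω, joinEntropy (ν : Measure Y) ξ (randomIterate f ω) n ∂(noiseMeasure θ)) / n) := by
    refine ⟨0, ?_⟩
    rintro _ ⟨n, rfl⟩
    exact div_nonneg (integral_nonneg fun ω => joinEntropy_nonneg ξ _ _ _) n.cast_nonneg
  have heq : meanRandomEntropy (ν : Measure Y) f θ ξ = fun n : ℕ =>
      (∫ ω, joinEntropy (ν : Measure Y) ξ (randomIterate f ω) n ∂(noiseMeasure θ)) / n := by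
    funext n
    rw [meanRandomEntropy, one_div_mul_eq_div]
  have hlim : Tendsto (meanRandomEntropy (ν : Measure Y) f θ ξ) atTop (𝓝 hsub.lim) :=
    heq ▸ hsub.tendsto_lim hbdd
  have hval : randomEntropy (ν : Measure Y) f θ ξ = hsub.lim := hlim.limUnder_eq
  rw [hval]
  exact ⟨hlim, fun n hn => by rw [heq]; exact hsub.lim_le_div hbdd hn⟩

end RandomSystem

/-! ### Deterministic systems as random systems with Dirac noise -/

section Dirac

variable {ι X Y : Type*} [Fintype ι] [MeasurableSpace X] [MeasurableSpace Y]
  (f : X → Y → Y) (t : X) (ξ : FinMeasPartition ι Y)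

theorem noiseMeasure_diracProba : noiseMeasure (diracProba t) = Measure.dirac fun _ => t :=
  Measure.infinitePi_dirac fun _ : ℕ => t

theorem meanRandomEntropy_diracProba [MeasurableSingletonClass X] (μ : Measure Y) :
    meanRandomEntropy μ f (diracProba t) ξ = meanEntropy μ (f t) ξ := by
  funext n
  rw [meanRandomEntropy, noiseMeasure_diracProba, integral_dirac, meanEntropy,
    funext (randomIterate_const f t)]

theorem randomEntropy_diracProba [MeasurableSingletonClass X] (μ : Measure Y) :
    randomEntropy μ f (diracProba t) ξ = entropy μ (f t) ξ := by
  rw [randomEntropy, entropy, meanRandomEntropy_diracProba]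

theorem sum_negMulLog_skewCell_diracProba (hf : Measurable fun p : X × Y => f p.1 p.2)
    (μ : ProbabilityMeasure Y) (n : ℕ) :
    ∑ a, Real.negMulLog (((noiseMeasure (diracProba t)).prod (μ : Measure Y)).real
        (skewCell f ξ n a)) = joinEntropy (μ : Measure Y) ξ (fun j => (f t)^[j]) n := by
  refine Finset.sum_congr rfl fun a _ => ?_
  rw [noiseMeasure_diracProba, Measure.dirac_prod, map_measureReal_apply measurable_prodMk_left
    (measurableSet_skewCell ξ hf n a), fibre_skewCell,
    funext (randomIterate_const f t)]

end Dirac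

/-! ### Weak convergence in the small noise limit -/

theorem frontier_iInter_subset_iUnion_frontier {α Z : Type*} [Finite α] [TopologicalSpace Z]
    (s : α → Set Z) : frontier (⋂ i, s i) ⊆ ⋃ i, frontier (s i) := by
  rintro z ⟨hcl, hint⟩
  rw [interior_iInter_of_finite, Set.mem_iInter, not_forall] at hint
  obtain ⟨i, hi⟩ := hint
  exact Set.mem_iUnion.2 ⟨i, closure_mono (Set.iInter_subset s i) hcl, hi⟩

theorem continuous_skewProduct {X Y : Type*} [TopologicalSpace X] [TopologicalSpace Y]
    {f : X → Y → Y} (hf : Continuous fun p : X × Y => f p.1 p.2) :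
    Continuous (skewProduct f) :=
  (continuous_pi fun n => (continuous_apply (n + 1)).comp continuous_fst).prodMk
    (hf.comp (f := fun p : (ℕ → X) × Y => (p.1 0, p.2))
      (((continuous_apply 0).comp continuous_fst).prodMk continuous_snd))

/-- For a stationary measure not charging `∂ξ`, invariance passes nullity of the boundary on to all
cells of the skew product. -/
theorem measure_frontier_skewCell {ι X Y : Type*} [Fintype ι]
    [TopologicalSpace X] [MeasurableSpace X] [TopologicalSpace Y] [MeasurableSpace Y] [BorelSpace Y]
    {f : X → Y → Y}
    (hf : Continuous fun p : X × Y => f p.1 p.2) {θ : ProbabilityMeasure X} {μ : ProbabilityMeasure Y} (hμ : IsStationary f θ μ)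
    (ξ : FinMeasPartition ι Y) (hξ : (μ : Measure Y) ξ.boundary = 0) (n : ℕ) (a : Fin n → ι) :
    ((noiseMeasure θ).prod (μ : Measure Y)) (frontier (skewCell f ξ n a)) = 0 := by
  have hF := continuous_skewProduct hf
  have hsub : frontier (skewCell f ξ n a) ⊆
      ⋃ j : Fin n, (skewProduct f)^[j] ⁻¹' (Prod.snd ⁻¹' frontier (ξ.cell (a j))) := by
    refine (frontier_iInter_subset_iUnion_frontier _).trans (Set.iUnion_mono fun j => ?_)
    exact (continuous_snd.comp (hF.iterate j)).frontier_preimage_subset _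
  refine measure_mono_null hsub (measure_iUnion_null fun j => ?_)
  have hms : MeasurableSet (Prod.snd ⁻¹' frontier (ξ.cell (a j)) : Set ((ℕ → X) × Y)) :=
    measurable_snd isClosed_frontier.measurableSet
  rw [(hμ.iterate j).measure_preimage hms.nullMeasurableSet, ← Set.univ_prod, Measure.prod_prod,
    measure_mono_null (Set.subset_iUnion (fun i => frontier (ξ.cell i)) (a j)) hξ, mul_zero]

section SmallNoise

variable {ι X Y : Type*} [Fintype ι]
    [MetricSpace X] [CompactSpace X] [MeasurableSpace X] [BorelSpace X]
    [MetricSpace Y] [CompactSpace Y] [MeasurableSpace Y] [BorelSpace Y]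

/-- The law `θ^ℕ` of the noise, bundled as a probability measure so as to use weak convergence. -/
noncomputable def noise (θ : ProbabilityMeasure X) : ProbabilityMeasure (ℕ → X) :=
  ⟨noiseMeasure θ, inferInstance⟩

theorem tendsto_noise {θ : ℕ → ProbabilityMeasure X} {t₀ : X}
    (h : ∀ U ∈ 𝓝 t₀, ∀ᶠ k in atTop, (θ k : Measure X).support ⊆ U) :
    Tendsto (fun k => noise (θ k)) atTop (𝓝 (noise (diracProba t₀))) := by
  refine tendsto_of_forall_isOpen_le_liminf fun G hG => ?_
  by_cases hG0 : (fun _ => t₀) ∈ G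
  · obtain ⟨I, u, hu, hIG⟩ := isOpen_pi_iff.1 hG _ hG0
    refine le_liminf_of_le (IsBoundedUnder.isCoboundedUnder_ge
      ⟨1, eventually_map.2 <| .of_forall fun k => ProbabilityMeasure.apply_le_one _ _⟩) ?_
    have hev : ∀ᶠ k in atTop, ∀ i ∈ I, (θ k : Measure X).support ⊆ u i :=
      (eventually_all_finset I).2 fun i hi => h _ ((hu i hi).1.mem_nhds (hu i hi).2)
    filter_upwards [hev] with k hk
    refine (ProbabilityMeasure.apply_le_one _ _).trans ?_
    refine le_trans ?_ (ProbabilityMeasure.apply_mono _ hIG)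
    -- `G` contains a cylinder whose finitely many sides contain the support of `θ k`.
    have hone : (noiseMeasure (θ k)) ((I : Set ℕ).pi u) = 1 := by
      rw [noiseMeasure, Measure.infinitePi_pi _ fun i hi => (hu i hi).1.measurableSet]
      refine Finset.prod_eq_one fun i hi => ?_
      refine le_antisymm prob_le_one ?_
      rw [← (prob_compl_eq_zero_iff (Measure.isClosed_support).measurableSet).1
        (Measure.measure_compl_support (μ := (θ k : Measure X)))]
      exact measure_mono (hk i hi)
    rw [ProbabilityMeasure.coeFn_def]
    change 1 ≤ (noiseMeasure (θ k) _).toNNReal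
    rw [hone, ENNReal.toNNReal_one]
  · have : noise (diracProba t₀) G = 0 := by
      rw [ProbabilityMeasure.null_iff_toMeasure_null]
      change noiseMeasure (diracProba t₀) G = 0
      rw [noiseMeasure_diracProba, Measure.dirac_apply' _ hG.measurableSet]
      simp [hG0]
    rw [this]
    exact bot_le

theorem tendsto_noise_prod {θ : ℕ → ProbabilityMeasure X} {t₀ : X}
    (h : ∀ U ∈ 𝓝 t₀, ∀ᶠ k in atTop, (θ k : Measure X).support ⊆ U)
    {ν : ℕ → ProbabilityMeasure Y} {μ : ProbabilityMeasure Y} (hμ : Tendsto ν atTop (𝓝 μ)) :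
    Tendsto (fun k => (noise (θ k)).prod (ν k)) atTop (𝓝 ((noise (diracProba t₀)).prod μ)) :=
  (ProbabilityMeasure.continuous_prod.tendsto _).comp ((tendsto_noise h).prodMk_nhds hμ)

/-- A weak limit of stationary measures, as the noise shrinks to `t₀`, is stationary for the Dirac
noise at `t₀`, that is, invariant under `f t₀`. -/
theorem isStationary_of_tendsto {f : X → Y → Y} (hf : Continuous fun p : X × Y => f p.1 p.2)
    {θ : ℕ → ProbabilityMeasure X} {t₀ : X}
    (h : ∀ U ∈ 𝓝 t₀, ∀ᶠ k in atTop, (θ k : Measure X).support ⊆ U)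
    {ν : ℕ → ProbabilityMeasure Y} {μ : ProbabilityMeasure Y} (hμ : Tendsto ν atTop (𝓝 μ))
    (hν : ∀ k, IsStationary f (θ k) (ν k)) : IsStationary f (diracProba t₀) μ := by
  have hF := continuous_skewProduct hf
  have h1 := tendsto_noise_prod h hμ
  have h2 := ProbabilityMeasure.tendsto_map_of_tendsto_of_continuous _ _ h1 hF
  have h3 (k) : ((noise (θ k)).prod (ν k)).map hF.measurable.aemeasurable =
      (noise (θ k)).prod (ν k) := Subtype.ext (hν k).map_eq
  simp only [h3] at h2
  exact ⟨hF.measurable, by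
    have h4 := congrArg ProbabilityMeasure.toMeasure (tendsto_nhds_unique h2 h1)
    rwa [ProbabilityMeasure.toMeasure_map] at h4⟩

/-- The upper bound of `integral_joinEntropy_le` converges to the entropy of the join of the
unperturbed map. -/
theorem tendsto_sum_negMulLog_skewCell {f : X → Y → Y}
    (hf : Continuous fun p : X × Y => f p.1 p.2)
    {θ : ℕ → ProbabilityMeasure X} {t₀ : X}
    (h : ∀ U ∈ 𝓝 t₀, ∀ᶠ k in atTop, (θ k : Measure X).support ⊆ U)
    {ν : ℕ → ProbabilityMeasure Y} {μ : ProbabilityMeasure Y} (hμ : Tendsto ν atTop (𝓝 μ))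
    (hν : ∀ k, IsStationary f (θ k) (ν k))
    (ξ : FinMeasPartition ι Y) (hξ : (μ : Measure Y) ξ.boundary = 0) (n : ℕ) :
    Tendsto (fun k => ∑ a, Real.negMulLog
        (((noiseMeasure (θ k)).prod (ν k : Measure Y)).real (skewCell f ξ n a))) atTop
      (𝓝 (joinEntropy (μ : Measure Y) ξ (fun j => (f t₀)^[j]) n)) := by
  rw [← sum_negMulLog_skewCell_diracProba f t₀ ξ hf.measurable μ n]
  refine tendsto_finsetSum _ fun a _ => (Real.continuous_negMulLog.tendsto _).comp ?_
  have hnull := measure_frontier_skewCell hf (isStationary_of_tendsto hf h hμ hν) ξ hξ n a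
  exact (ENNReal.tendsto_toReal (measure_ne_top _ _)).comp
    (ProbabilityMeasure.tendsto_measure_of_null_frontier_of_tendsto'
      (tendsto_noise_prod h hμ) hnull)

end SmallNoise

end RandomEntropy

theorem theorem15 {X Y ι : Type*}
    [MetricSpace X] [CompactSpace X] [MeasurableSpace X] [BorelSpace X]
    [MetricSpace Y] [CompactSpace Y] [MeasurableSpace Y] [BorelSpace Y]
    [Fintype ι]
    (f : X → Y → Y) (hf : Continuous (fun p : X × Y => f p.1 p.2))
    (t₀ : X)
    (θ : ℝ → ProbabilityMeasure X)
    (hθ_nonatomic : ∀ δ : ℝ, 0 < δ → ∀ t : X, (θ δ : Measure X) {t} = 0)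
    (hθ_supp : ∀ U ∈ 𝓝 t₀, ∀ᶠ δ in 𝓝[>] (0 : ℝ), (θ δ : Measure X).support ⊆ U)
    (ε : ℕ → ℝ) (hε_pos : ∀ k, 0 < ε k) (hε : Tendsto ε atTop (𝓝 0))
    (ν : ℕ → ProbabilityMeasure Y)
    (hν : ∀ k, RandomEntropy.IsStationary f (θ (ε k)) (ν k))
    (μ : ProbabilityMeasure Y) (hμ : Tendsto ν atTop (𝓝 μ))
    (ξ : RandomEntropy.FinMeasPartition ι Y)
    (hξ_gen : ∀ k, RandomEntropy.IsRandomGenerating (ν k : Measure Y) f (θ (ε k)) ξ)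
    (hξ_bd : (μ : Measure Y) ξ.boundary = 0) :
    (∀ k, Tendsto (RandomEntropy.meanRandomEntropy (ν k : Measure Y) f (θ (ε k)) ξ) atTop
      (𝓝 (RandomEntropy.randomEntropy (ν k : Measure Y) f (θ (ε k)) ξ))) ∧
    Tendsto (RandomEntropy.meanEntropy (μ : Measure Y) (f t₀) ξ) atTop
      (𝓝 (RandomEntropy.entropy (μ : Measure Y) (f t₀) ξ)) ∧
    limsup (fun k => ((RandomEntropy.randomEntropy (ν k : Measure Y) f (θ (ε k)) ξ : ℝ) : EReal))
      atTop ≤ ((RandomEntropy.entropy (μ : Measure Y) (f t₀) ξ : ℝ) : EReal) := by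
  have hU : ∀ U ∈ 𝓝 t₀, ∀ᶠ k in atTop, (θ (ε k) : Measure X).support ⊆ U := fun U hU =>
    (tendsto_nhdsWithin_iff.2 ⟨hε, .of_forall hε_pos⟩).eventually (hθ_supp U hU)
  have hlim₀ := RandomEntropy.tendsto_meanRandomEntropy_and_le _ ξ hf.measurable
    (RandomEntropy.isStationary_of_tendsto hf hU hμ hν)
  rw [RandomEntropy.meanRandomEntropy_diracProba, RandomEntropy.randomEntropy_diracProba] at hlim₀
  have hlim (k) := RandomEntropy.tendsto_meanRandomEntropy_and_le _ ξ hf.measurable (hν k)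
  refine ⟨fun k => (hlim k).1, hlim₀.1, ?_⟩
  -- The entropy of `f t₀` is the limit of its mean entropies, each of which bounds the `limsup`.
  refine ge_of_tendsto ((continuous_coe_real_ereal.tendsto _).comp hlim₀.1) ?_
  filter_upwards [eventually_ne_atTop 0] with n hn
  have hconv := (RandomEntropy.tendsto_sum_negMulLog_skewCell hf hU hμ hν ξ hξ_bd n).const_mul
    (1 / (n : ℝ))
  refine (limsup_le_limsup (.of_forall fun k => EReal.coe_le_coe_iff.2 ?_)).trans_eq
    ((continuous_coe_real_ereal.tendsto _).comp hconv).limsup_eq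
  refine ((hlim k).2 n hn).trans ?_
  exact mul_le_mul_of_nonneg_left (RandomEntropy.integral_joinEntropy_le _ ξ _ hf.measurable n)
    (by positivity)
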